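/- Let $G$ be a finite simple graph on $n$ vertices that contains neither a triangle nor a co-diamond as an induced subgraph, where the co-diamond is the complement of $K_4$ minus an edge (that is, the disjoint union of one edge and two isolated vertices). Let $\ell\ge\chi(G)+1$ be an integer, and let $\mathcal{C}_\ell(G)$ be the graph whose vertices are the proper $\ell$-colourings of $G$ (with colours $1,\dots,\ell$), two colourings being adjacent if and only if they differ in the colour of exactly one vertex of $G$. If $G$ is not isomorphic to the complete bipartite graph $K_{\ell,\ell}$ minus a perfect matching (for this same $\ell$), then $$\operatorname{diam}\mathcal{C}_\ell(G)\le\lfloor 5.5\,n\rfloor ,$$ where the diameter of a disconnected graph is $\infty$ (so, in particular, $\mathcal{C}_\ell(G)$ is connected). -/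

import Mathlib

/-- The `k`-recolouring graph of `G`: its vertices are the proper `k`-colourings of `G`, and two
of them are adjacent precisely when they differ in the colour of exactly one vertex of `G`. -/
def recolouringGraph {V : Type*} (G : SimpleGraph V) (k : ℕ) : SimpleGraph (G.Coloring (Fin k)) where
  Adj α β := ∃! v, α v ≠ β v
  symm := ⟨fun α β h => by simpa only [ne_comm] using h⟩
  loopless := ⟨fun α ⟨_, hv, _⟩ => hv rfl⟩

/-- The diamond: the complete graph on four vertices minus one edge. -/
def diamond : SimpleGraph (Fin 4) :=
  (⊤ : SimpleGraph (Fin 4)).deleteEdges {s(0, 1)}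

/-- The co-diamond: the complement of the diamond, that is, one edge and two isolated vertices. -/
def coDiamond : SimpleGraph (Fin 4) := diamondᶜ

/-- The complete bipartite graph with both parts of size `m`, minus a perfect matching. -/
def completeBipartiteMinusPerfectMatching (m : ℕ) : SimpleGraph (Fin m ⊕ Fin m) :=
  (completeBipartiteGraph (Fin m) (Fin m)).deleteEdges
    (Set.range fun i : Fin m => s(Sum.inl i, Sum.inr i))

/-! An independent set whose neighbourhood avoids a colour can be given that colour at one step per
vertex. An edgeless graph is immediate; otherwise there are two cases. If `G` is bipartite, then `ℓ
≥ 3`. A colouring using every colour on both parts would force `G` to be the excluded graph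
(`nonempty_iso_of_forall_colour`). So some colour misses a part, and `n` steps reach a colouring
constant on each part; two of these are within `2n`, for a total of `4n`. If `G` is not bipartite,
it contains a 5-cycle (`exists_five_cycle`) and nothing else (`eq_of_five_cycle`). Then `ℓ ≥ 4`, and
normal forms give distance at most `21 ≤ ⌊5.5 · 5⌋`. -/

section Recolouring

/-! ### Recolouring independent sets. -/

variable {V : Type*} {G : SimpleGraph V} {k : ℕ}

/-- Colourings that differ only on an independent set `S` are at distance at most `#S`. -/
theorem recolouringGraph_edist_le_card (β : G.Coloring (Fin k)) (S : Finset V)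
    (hS : G.IsIndepSet (S : Set V)) (α : G.Coloring (Fin k)) (h : ∀ v ∉ S, α v = β v) :
    (recolouringGraph G k).edist α β ≤ (S.card : ℕ∞) := by
  classical
  induction S using Finset.induction_on generalizing α with
  | empty =>
    have : α = β := RelHom.ext fun v => h v (by simp)
    simp [this]
  | insert a S ha ih =>
    have hS' : G.IsIndepSet (S : Set V) := hS.mono (by simp)
    by_cases hab : α a = β a
    · refine (ih hS' α fun v hv => ?_).trans (by simp [Finset.card_insert_of_notMem ha])
      by_cases hva : v = a
      · rw [hva, hab]
      · exact h v (by simp [hva, hv])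
    -- Independence puts all neighbours of `a` outside the set, so they already have their final
    -- colours and `a` can safely take its own.
    have key : ∀ w, G.Adj a w → α w = β w := by
      intro w haw
      by_cases hw : w ∈ insert a S
      · exact absurd haw (hS (by simp) (by simpa using hw) haw.ne)
      · exact h w hw
    let γ : G.Coloring (Fin k) := SimpleGraph.Coloring.mk (Function.update α a (β a)) (by
      intro v w hvw
      by_cases hv : v = a
      · subst hv
        rw [Function.update_self, Function.update_of_ne hvw.ne', key w hvw]
        exact β.valid hvw
      · by_cases hw : w = a
        · subst hw
          rw [Function.update_self, Function.update_of_ne hv, key v hvw.symm]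
          exact β.valid hvw
        · rw [Function.update_of_ne hv, Function.update_of_ne hw]
          exact α.valid hvw)
    have hγ : ∀ v, γ v = Function.update α a (β a) v := fun v => rfl
    have hadj : (recolouringGraph G k).Adj α γ := by
      refine ⟨a, by simpa [hγ] using hab, fun v hv => ?_⟩
      by_contra hva
      exact hv (by simp [hγ, Function.update_of_ne hva])
    have h1 : (recolouringGraph G k).edist α γ = 1 := SimpleGraph.edist_eq_one_iff_adj.2 hadj
    have h2 : (recolouringGraph G k).edist γ β ≤ (S.card : ℕ∞) := by
      refine ih hS' γ fun v hv => ?_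
      by_cases hva : v = a
      · simp [hγ, hva]
      · rw [hγ, Function.update_of_ne hva]
        exact h v (by simp [hva, hv])
    calc (recolouringGraph G k).edist α β
        ≤ (recolouringGraph G k).edist α γ + (recolouringGraph G k).edist γ β :=
          SimpleGraph.edist_triangle
      _ ≤ 1 + (S.card : ℕ∞) := by rw [h1]; gcongr
      _ = ((insert a S).card : ℕ∞) := by
          rw [Finset.card_insert_of_notMem ha]; push_cast; rw [add_comm]

/-- An independent set can be given a colour absent from its neighbourhood. -/
theorem exists_recolour (α : G.Coloring (Fin k)) (S : Finset V)
    (hS : G.IsIndepSet (S : Set V)) (c : Fin k)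
    (hc : ∀ v ∈ S, ∀ w, G.Adj v w → α w ≠ c) :
    ∃ β : G.Coloring (Fin k), (∀ v ∈ S, β v = c) ∧ (∀ v ∉ S, β v = α v) ∧
      (recolouringGraph G k).edist α β ≤ (S.card : ℕ∞) := by
  classical
  let β : G.Coloring (Fin k) := SimpleGraph.Coloring.mk (fun v => if v ∈ S then c else α v) (by
    intro v w hvw
    by_cases hv : v ∈ S <;> by_cases hw : w ∈ S
    · exact absurd hvw (hS hv hw hvw.ne)
    · simpa [hv, hw] using (hc v hv w hvw).symm
    · simpa [hv, hw] using hc w hw v hvw.symm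
    · simpa [hv, hw] using α.valid hvw)
  have hβ : ∀ v, β v = if v ∈ S then c else α v := fun v => rfl
  refine ⟨β, fun v hv => by simp [hβ, hv], fun v hv => by simp [hβ, hv], ?_⟩
  exact recolouringGraph_edist_le_card β S hS α fun v hv => by simp [hβ, hv]

theorem edist_le_of_le_of_le {W : Type*} {H : SimpleGraph W} {a b c : W} {m n : ℕ}
    (h₁ : H.edist a b ≤ (m : ℕ∞)) (h₂ : H.edist b c ≤ (n : ℕ∞)) :
    H.edist a c ≤ ((m + n : ℕ) : ℕ∞) := by
  push_cast
  exact SimpleGraph.edist_triangle.trans (add_le_add h₁ h₂)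

/-- There is a colour outside any short list of colours. -/
theorem exists_colour_notMem (s : Finset (Fin k)) (h : s.card < k) : ∃ c, c ∉ s := by
  by_contra! hs
  have : s = Finset.univ := Finset.eq_univ_of_forall hs
  simp [this] at h

/-! ### Recolouring bipartite graphs. -/

section Bipartite

variable {A B : Finset V}

/-- As `c` is absent from `B`, all of `A` can move to `c`; then `B` sees only `c` and can move to
any other colour. -/
theorem exists_two_colouring_of_missing (hA : G.IsIndepSet (A : Set V))
    (hB : G.IsIndepSet (B : Set V)) (hAB : ∀ v, v ∈ A ↔ v ∉ B) (hk : 2 ≤ k)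
    (α : G.Coloring (Fin k)) (c : Fin k) (hc : ∀ v ∈ B, α v ≠ c) :
    ∃ (β : G.Coloring (Fin k)) (d : Fin k), c ≠ d ∧ (∀ v ∈ A, β v = c) ∧ (∀ v ∈ B, β v = d) ∧
      (recolouringGraph G k).edist α β ≤ ((A.card + B.card : ℕ) : ℕ∞) := by
  obtain ⟨d, hd⟩ := exists_colour_notMem {c} (by simpa using (by omega : 1 < k))
  have hcd : c ≠ d := fun h => hd (by simp [h])
  obtain ⟨γ, h1, h2, h3⟩ := exists_recolour α A hA c fun v hv w hvw =>
    hc w (by_contra fun hw => hA hv ((hAB w).2 hw) hvw.ne hvw)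
  obtain ⟨β, h4, h5, h6⟩ := exists_recolour γ B hB d fun v hv w hvw => by
    rw [h1 w ((hAB w).2 fun hw => hB hv hw hvw.ne hvw)]
    exact hcd
  exact ⟨β, d, hcd, fun v hv => (h5 v ((hAB v).1 hv)).trans (h1 v hv), h4,
    edist_le_of_le_of_le h3 h6⟩

/-- Two colourings that are constant on the same part of a bipartite graph are close. -/
theorem edist_two_colourings_le (hA : G.IsIndepSet (A : Set V))
    (hB : G.IsIndepSet (B : Set V)) (hAB : ∀ v, v ∈ A ↔ v ∉ B) (hk : 3 ≤ k)
    (α β : G.Coloring (Fin k)) {q s : Fin k}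
    (hαB : ∀ v ∈ B, α v = q) (hβB : ∀ v ∈ B, β v = s) :
    (recolouringGraph G k).edist α β ≤ ((A.card + B.card + A.card : ℕ) : ℕ∞) := by
  -- `A` is parked on `t` while `B` passes from `q` to `s`, so it is paid for twice.
  obtain ⟨t, ht⟩ := exists_colour_notMem {q, s} (lt_of_le_of_lt Finset.card_le_two (by omega))
  simp only [Finset.mem_insert, Finset.mem_singleton, not_or] at ht
  have nbA : ∀ v ∈ A, ∀ w, G.Adj v w → w ∈ B := fun v hv w hvw =>
    by_contra fun hw => hA hv ((hAB w).2 hw) hvw.ne hvw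
  have nbB : ∀ v ∈ B, ∀ w, G.Adj v w → w ∈ A := fun v hv w hvw =>
    (hAB w).2 fun hw => hB hv hw hvw.ne hvw
  obtain ⟨γ, h1, h2, h3⟩ := exists_recolour α A hA t fun v hv w hvw => by
    rw [hαB w (nbA v hv w hvw)]; exact Ne.symm ht.1
  obtain ⟨δ, h4, h5, h6⟩ := exists_recolour γ B hB s fun v hv w hvw => by
    rw [h1 w (nbB v hv w hvw)]; exact ht.2
  have h7 : (recolouringGraph G k).edist δ β ≤ (A.card : ℕ∞) := by
    refine recolouringGraph_edist_le_card β A hA δ fun v hv => ?_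
    have hvB : v ∈ B := by_contra fun hw => hv ((hAB v).2 hw)
    rw [h4 v hvB, hβB v hvB]
  exact edist_le_of_le_of_le (edist_le_of_le_of_le h3 h6) h7

theorem exists_two_colouring (hA : G.IsIndepSet (A : Set V))
    (hB : G.IsIndepSet (B : Set V)) (hAB : ∀ v, v ∈ A ↔ v ∉ B) (hk : 2 ≤ k)
    (α : G.Coloring (Fin k)) (h : ∃ c, (∀ v ∈ A, α v ≠ c) ∨ ∀ v ∈ B, α v ≠ c) :
    ∃ (β : G.Coloring (Fin k)) (c d : Fin k), c ≠ d ∧ (∀ v ∈ A, β v = c) ∧ (∀ v ∈ B, β v = d) ∧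
      (recolouringGraph G k).edist α β ≤ ((A.card + B.card : ℕ) : ℕ∞) := by
  obtain ⟨c, hc | hc⟩ := h
  · obtain ⟨β, d, h1, h2, h3, h4⟩ :=
      exists_two_colouring_of_missing hB hA (fun v => by rw [hAB v, not_not]) hk α c hc
    exact ⟨β, d, c, h1.symm, h3, h2, by rwa [add_comm]⟩
  · obtain ⟨β, d, h1, h2, h3, h4⟩ := exists_two_colouring_of_missing hA hB hAB hk α c hc
    exact ⟨β, c, d, h1, h2, h3, h4⟩

/-- If in both colourings of a bipartite graph some colour misses one of the parts, then the
colourings are at distance at most four times the number of vertices. -/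
theorem edist_le_of_missing (hA : G.IsIndepSet (A : Set V))
    (hB : G.IsIndepSet (B : Set V)) (hAB : ∀ v, v ∈ A ↔ v ∉ B) (hk : 3 ≤ k)
    (α β : G.Coloring (Fin k)) (hα : ∃ c, (∀ v ∈ A, α v ≠ c) ∨ ∀ v ∈ B, α v ≠ c)
    (hβ : ∃ c, (∀ v ∈ A, β v ≠ c) ∨ ∀ v ∈ B, β v ≠ c) :
    (recolouringGraph G k).edist α β ≤ ((4 * (A.card + B.card) : ℕ) : ℕ∞) := by
  obtain ⟨α', -, q, -, -, h2, h3⟩ := exists_two_colouring hA hB hAB (by omega) α hα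
  obtain ⟨β', -, s, -, -, h5, h6⟩ := exists_two_colouring hA hB hAB (by omega) β hβ
  rw [SimpleGraph.edist_comm] at h6
  have h7 := edist_two_colourings_le hA hB hAB hk α' β' h2 h5
  refine (edist_le_of_le_of_le (edist_le_of_le_of_le h3 h7) h6).trans ?_
  exact_mod_cast (by omega)

end Bipartite

end Recolouring

/-! ### Structure of triangle-free and co-diamond-free graphs. -/

section Structure

variable {V : Type*} {G : SimpleGraph V}

theorem not_adj_of_cliqueFree_three (h : G.CliqueFree 3) {a b c : V} (hab : G.Adj a b)
    (hac : G.Adj a c) : ¬ G.Adj b c := by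
  classical
  exact fun hbc => h {a, b, c} (SimpleGraph.is3Clique_triple_iff.2 ⟨hab, hac, hbc⟩)

/-- In a co-diamond-free graph the vertices that miss an edge form a clique. -/
theorem adj_of_not_coDiamond (h : ¬ coDiamond.IsIndContained G) {x y z w : V}
    (hxy : G.Adj x y) (hzw : z ≠ w) (hxz : ¬ G.Adj x z) (hxw : ¬ G.Adj x w)
    (hyz : ¬ G.Adj y z) (hyw : ¬ G.Adj y w) : G.Adj z w := by
  by_contra hn
  have h1 : x ≠ y := hxy.ne
  have h2 : x ≠ z := by rintro rfl; exact hyz hxy.symm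
  have h3 : x ≠ w := by rintro rfl; exact hyw hxy.symm
  have h4 : y ≠ z := by rintro rfl; exact hxz hxy
  have h5 : y ≠ w := by rintro rfl; exact hxw hxy
  refine h ⟨⟨⟨![x, y, z, w], ?_⟩, ?_⟩⟩
  · intro i j hij
    fin_cases i <;> fin_cases j <;> simp_all
  · intro i j
    change G.Adj (![x, y, z, w] i) (![x, y, z, w] j) ↔ _
    have hs := fun u v => G.adj_comm u v
    fin_cases i <;> fin_cases j <;>
      simp [coDiamond, diamond, hxy, hxy.symm, hxz, hxw, hyz, hyw, hn, hs z, hs w]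

/-- A bipartite co-diamond-free graph with an edge that has a colouring with at least two
colours, all of them appearing on both parts, is a balanced complete bipartite graph minus a
perfect matching. -/
theorem nonempty_iso_of_forall_colour {k : ℕ}
    (hco : ¬ coDiamond.IsIndContained G) (P : V → Prop)
    (hP : ∀ x y, G.Adj x y → (P x ↔ ¬ P y)) (hk : 2 ≤ k) {x₀ y₀ : V} (h₀ : G.Adj x₀ y₀)
    (α : G.Coloring (Fin k)) (hα : ∀ c, (∃ v, P v ∧ α v = c) ∧ ∃ v, ¬ P v ∧ α v = c) :
    Nonempty (G ≃g completeBipartiteMinusPerfectMatching k) := by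
  have co := @adj_of_not_coDiamond V G hco
  choose f hfP hf using fun c => (hα c).1
  choose g hgP hg using fun c => (hα c).2
  have nfg : ∀ v w, α v = α w → ¬ G.Adj v w := fun v w h hvw => α.valid hvw h
  have same : ∀ v w, (P v ↔ P w) → ¬ G.Adj v w := fun v w h hvw => by
    have := hP v w hvw; tauto
  -- If `z` were isolated, every edge would dominate all other vertices. But an edge from `f c` to
  -- some `u` outside `P` cannot dominate `g c`, which shares its colour with `f c` and its part
  -- with `u`.
  have hiso : ∀ z, ∃ w, G.Adj z w := by
    intro z
    by_contra! hz
    obtain ⟨c, hc⟩ := exists_colour_notMem {α z} (by simpa using (by omega : 1 < k))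
    have hcz : α z ≠ c := fun h => hc (by simp [h])
    have hfz : f c ≠ z := fun h => hcz (by rw [← h, hf])
    have hgz : g c ≠ z := fun h => hcz (by rw [← h, hg])
    have key : ∀ x y, G.Adj x y → ∀ w, w ≠ z → G.Adj x w ∨ G.Adj y w := by
      intro x y hxy w hw
      by_contra! hn
      exact hz w ((co hxy hw hn.1 (fun h => hz x h.symm) hn.2 (fun h => hz y h.symm)).symm)
    have h1 := key x₀ y₀ h₀ (f c) hfz
    have h2 := key x₀ y₀ h₀ (g c) hgz
    have hfg : ¬ G.Adj (f c) (g c) := nfg _ _ (by rw [hf, hg])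
    have h3 : ∃ u, G.Adj u (f c) ∧ ¬ P u := by
      rcases h1 with h | h
      · exact ⟨_, h, by have := hP _ _ h; have := hfP c; tauto⟩
      · exact ⟨_, h, by have := hP _ _ h; have := hfP c; tauto⟩
    obtain ⟨u, hu, hPu⟩ := h3
    rcases key u (f c) hu (g c) hgz with h | h
    · exact same u (g c) (by have := hgP c; tauto) h
    · exact hfg h
  -- A vertex has at most one non-neighbour across: two of them would both miss an edge at `x`,
  -- hence be adjacent within one part. So each colour occurs once per part.
  have uniq : ∀ x y z, (P y ↔ P z) → (P x ↔ ¬ P y) → ¬ G.Adj x y → ¬ G.Adj x z → y = z := by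
    intro x y z hyz hxy h1 h2
    by_contra hne
    obtain ⟨w, hw⟩ := hiso x
    have := hP _ _ hw
    exact same y z hyz (co hw hne h1 h2 (same _ _ (by tauto)) (same _ _ (by tauto)))
  have hfα : ∀ x, P x → f (α x) = x := fun x hx =>
    uniq (g (α x)) _ _ (by have := hfP (α x); tauto)
      (by have := hfP (α x); have := hgP (α x); tauto)
      (nfg _ _ (by rw [hf, hg])) (nfg _ _ (by rw [hg]))
  have hgα : ∀ x, ¬ P x → g (α x) = x := fun x hx =>
    uniq (f (α x)) _ _ (by have := hgP (α x); tauto)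
      (by have := hfP (α x); have := hgP (α x); tauto)
      (nfg _ _ (by rw [hf, hg])) (nfg _ _ (by rw [hf]))
  have hfg : ∀ c d, G.Adj (f c) (g d) ↔ c ≠ d := by
    intro c d
    constructor
    · rintro h rfl
      exact nfg _ _ (by rw [hf, hg]) h
    · intro hcd
      by_contra h
      have := uniq (f c) (g c) (g d) (by have := hgP c; have := hgP d; tauto)
        (by have := hfP c; have := hgP c; tauto) (nfg _ _ (by rw [hf, hg])) h
      exact hcd (by rw [← hg c, this, hg])
  classical
  let e : Fin k ⊕ Fin k ≃ V :=
    { toFun := Sum.elim f g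
      invFun := fun v => if P v then Sum.inl (α v) else Sum.inr (α v)
      left_inv := by rintro (c | c) <;> simp [hfP, hgP, hf, hg]
      right_inv := by
        intro v
        by_cases hv : P v
        · simp [hv, hfα v hv]
        · simp [hv, hgα v hv] }
  refine ⟨SimpleGraph.Iso.symm ⟨e, ?_⟩⟩
  rintro (c | c) (d | d)
  · have : ¬ G.Adj (f c) (f d) := same _ _ (by have := hfP c; have := hfP d; tauto)
    simpa [e, completeBipartiteMinusPerfectMatching] using this
  · simp [e, completeBipartiteMinusPerfectMatching, hfg]
  · rw [SimpleGraph.adj_comm, SimpleGraph.adj_comm _ (Sum.inr c)]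
    simp [e, completeBipartiteMinusPerfectMatching, hfg]
  · have : ¬ G.Adj (g c) (g d) := same _ _ (by have := hgP c; have := hgP d; tauto)
    simpa [e, completeBipartiteMinusPerfectMatching] using this

/-- A triangle-free co-diamond-free graph that contains a cycle of length five has no further
vertices. -/
theorem eq_of_five_cycle (hT : G.CliqueFree 3) (hco : ¬ coDiamond.IsIndContained G)
    {a b c d e : V} (hab : G.Adj a b) (hbc : G.Adj b c) (hcd : G.Adj c d) (hde : G.Adj d e)
    (hea : G.Adj e a) (v : V) : v = a ∨ v = b ∨ v = c ∨ v = d ∨ v = e := by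
  have tr : ∀ x y z, G.Adj x y → G.Adj x z → ¬ G.Adj y z := fun x y z =>
    not_adj_of_cliqueFree_three hT
  have co : ∀ x y z w, G.Adj x y → z ≠ w → ¬ G.Adj x z → ¬ G.Adj x w → ¬ G.Adj y z →
    ¬ G.Adj y w → G.Adj z w := fun x y z w => adj_of_not_coDiamond hco
  by_contra! hv
  obtain ⟨ha, hb, hc, hd, he⟩ := hv
  have nac := tr b a c hab.symm hbc
  have nbd := tr c b d hbc.symm hcd
  have nce := tr d c e hcd.symm hde
  have nda := tr e d a hde.symm hea
  have neb := tr a e b hea.symm hab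
  -- The neighbours of `v` on the cycle are independent, so up to rotation they lie in `{a, c}`.
  -- Then `v` and `b` are non-adjacent and both miss `de`, a co-diamond.
  have t1 := tr v a b
  have t2 := tr v b c
  have t3 := tr v c d
  have t4 := tr v d e
  have t5 := tr v e a
  have c1 := co a b v d hab hd
  have c2 := co b c v e hbc he
  have c3 := co c d v a hcd ha
  have c4 := co d e v b hde hb
  have c5 := co e a v c hea hc
  have s1 := G.adj_comm a
  have s2 := G.adj_comm v
  have s3 := G.adj_comm b d
  have s4 := G.adj_comm c e
  have s5 := G.adj_comm b e
  clear tr co hco hT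
  grind

/-- A triangle-free co-diamond-free graph that is not bipartite contains a cycle of length five. -/
theorem exists_five_cycle (hT : G.CliqueFree 3) (hco : ¬ coDiamond.IsIndContained G)
    (h2 : ¬ ∃ P : V → Prop, ∀ x y, G.Adj x y → (P x ↔ ¬ P y)) :
    ∃ a b c d e, G.Adj a b ∧ G.Adj b c ∧ G.Adj c d ∧ G.Adj d e ∧ G.Adj e a := by
  have tr : ∀ x y z, G.Adj x y → G.Adj x z → ¬ G.Adj y z := fun x y z =>
    not_adj_of_cliqueFree_three hT
  by_contra! hC
  obtain ⟨x, y, hxy⟩ : ∃ x y, G.Adj x y := by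
    by_contra! h
    exact h2 ⟨fun _ => True, fun x y hxy => absurd hxy (h x y)⟩
  -- The vertices missing `xy` form a clique, so there are at most two; the task is to distribute
  -- them between the independent sets `N(x)` and `N(y)`.
  have co : ∀ z w, z ≠ w → ¬ G.Adj x z → ¬ G.Adj x w → ¬ G.Adj y z →
    ¬ G.Adj y w → G.Adj z w := fun z w => adj_of_not_coDiamond hco hxy
  have five : ∀ b e c d, G.Adj x b → G.Adj x e → G.Adj b c → G.Adj e d → ¬ G.Adj c d :=
    fun b e c d h1 h2 h3 h4 h5 => hC x b c d e h1 h3 h5 h4.symm h2.symm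
  have five' : ∀ b e c d, G.Adj y b → G.Adj y e → G.Adj b c → G.Adj e d → ¬ G.Adj c d :=
    fun b e c d h1 h2 h3 h4 h5 => hC y b c d e h1 h3 h5 h4.symm h2.symm
  have five'' : ∀ p q z, G.Adj x p → G.Adj y q → G.Adj z p → ¬ G.Adj z q :=
    fun p q z h1 h2 h3 h4 => hC x p z q y h1 h3.symm h4 h2.symm hxy.symm
  -- no set `T` of vertices missing the edge `xy` can join the neighbours of `x` to form a part
  have bip : ∀ T : V → Prop, (∀ v, T v → ¬ G.Adj x v ∧ ¬ G.Adj y v) →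
      (∀ v p, T v → G.Adj x p → ¬ G.Adj v p) →
      (∀ v q, ¬ G.Adj x v → ¬ G.Adj y v → ¬ T v → G.Adj y q → ¬ G.Adj v q) →
      (∀ v w, T v → T w → ¬ G.Adj v w) →
      (∀ v w, ¬ G.Adj x v → ¬ G.Adj y v → ¬ T v → ¬ G.Adj x w → ¬ G.Adj y w → ¬ T w →
        ¬ G.Adj v w) → False := by
    intro T h1 h3 h4 h5 h6
    refine h2 ⟨fun v => G.Adj x v ∨ T v, fun u v huv => ?_⟩
    have a1 := tr x u v
    have a2 := tr y u v
    have a3 := h3 u v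
    have a4 := h3 v u
    have a5 := h4 u v
    have a6 := h4 v u
    have a7 := h5 u v
    have a8 := h6 u v
    have h7 := h1 u
    have h8 := h1 v
    have h9 := huv.symm
    clear h1 h3 h4 h5 h6 five five' five'' co tr hC h2 hT hco
    by_cases G.Adj y u <;> by_cases G.Adj y v <;> grind
  have single : ∀ z, ¬ G.Adj x z → ¬ G.Adj y z → (∀ p, G.Adj x p → ¬ G.Adj z p) →
      (∀ v q, ¬ G.Adj x v → ¬ G.Adj y v → v ≠ z → G.Adj y q → ¬ G.Adj v q) → False := by
    intro z hxz hyz h1 h3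
    refine bip (fun v => v = z) ?_ ?_ h3 ?_ ?_
    · rintro v rfl; exact ⟨hxz, hyz⟩
    · rintro v p rfl; exact h1 p
    · rintro v w rfl rfl; exact G.loopless.irrefl _
    · intro v w hxv hyv hv hxw hyw hw
      exact tr z v w (co z v (Ne.symm hv) hxz hxv hyz hyv) (co z w (Ne.symm hw) hxz hxw hyz hyw)
  -- A vertex `z` with a neighbour in `N(x)` must join `N(y)`, and any other vertex missing `xy`
  -- joins `N(x)`; each obstruction closes a 5-cycle.
  by_cases hU : ∃ z, ¬ G.Adj x z ∧ ¬ G.Adj y z ∧ ∃ p, G.Adj x p ∧ G.Adj z p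
  · obtain ⟨z, hxz, hyz, p, hxp, hzp⟩ := hU
    refine bip (fun v => ¬ G.Adj x v ∧ ¬ G.Adj y v ∧ v ≠ z) (fun v hv => ⟨hv.1, hv.2.1⟩) ?_ ?_ ?_ ?_
    · rintro v q ⟨hxv, hyv, hv⟩ hxq hvq
      exact five p q z v hxp hxq hzp.symm hvq.symm (co z v hv.symm hxz hxv hyz hyv)
    · intro v q hxv hyv hv hyq
      obtain rfl : v = z := by tauto
      exact five'' p q v hxp hyq hzp
    · rintro v w ⟨hxv, hyv, hv⟩ ⟨hxw, hyw, hw⟩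
      exact tr z v w (co z v hv.symm hxz hxv hyz hyv) (co z w hw.symm hxz hxw hyz hyw)
    · intro v w hxv hyv hv hxw hyw hw
      obtain rfl : v = z := by tauto
      obtain rfl : w = v := by tauto
      exact G.loopless.irrefl _
  · have hX : ∀ z, ¬ G.Adj x z → ¬ G.Adj y z → ∀ p, G.Adj x p → ¬ G.Adj z p :=
      fun z h1 h2 p h3 h4 => hU ⟨z, h1, h2, p, h3, h4⟩
    by_cases hY : ∃ z, ¬ G.Adj x z ∧ ¬ G.Adj y z ∧ ∃ q, G.Adj y q ∧ G.Adj z q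
    · obtain ⟨z, hxz, hyz, p, hyp, hzp⟩ := hY
      refine single z hxz hyz (hX z hxz hyz) fun v q hxv hyv hv hyq hvq => ?_
      exact five' p q z v hyp hyq hzp.symm hvq.symm (co z v hv.symm hxz hxv hyz hyv)
    · have hY' : ∀ z, ¬ G.Adj x z → ¬ G.Adj y z → ∀ p, G.Adj y p → ¬ G.Adj z p :=
        fun z h1 h2 p h3 h4 => hY ⟨z, h1, h2, p, h3, h4⟩
      by_cases hne : ∃ z, ¬ G.Adj x z ∧ ¬ G.Adj y z
      · obtain ⟨z, hxz, hyz⟩ := hne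
        exact single z hxz hyz (hX z hxz hyz) fun v q hxv hyv _ => hY' v hxv hyv q
      · push Not at hne
        exact bip (fun _ => False) (by simp) (by simp)
          (fun v q h1 h2 => absurd (hne v h1) h2) (by simp)
          (fun v w h1 h2 => absurd (hne v h1) h2)

end Structure

/-! ### Recolouring the 5-cycle. -/

/-- Colourings of the cycle of length five with at least four colours are at distance at most
twenty-one. -/
theorem edist_le_of_five_cycle {V : Type*} {G : SimpleGraph V} {k : ℕ} (hT : G.CliqueFree 3)
    {a b c d e : V} (hab : G.Adj a b) (hbc : G.Adj b c) (hcd : G.Adj c d) (hde : G.Adj d e)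
    (hea : G.Adj e a) (hall : ∀ v, v = a ∨ v = b ∨ v = c ∨ v = d ∨ v = e) (hk : 4 ≤ k)
    (α β : G.Coloring (Fin k)) : (recolouringGraph G k).edist α β ≤ ((21 : ℕ) : ℕ∞) := by
  classical
  have tr : ∀ x y z, G.Adj x y → G.Adj x z → ¬ G.Adj y z := fun x y z =>
    not_adj_of_cliqueFree_three hT
  have nac := tr b a c hab.symm hbc
  have nbd := tr c b d hbc.symm hcd
  have nce := tr d c e hcd.symm hde
  have nda := tr e d a hde.symm hea
  have neb := tr a e b hea.symm hab
  have sym : ∀ x y, ¬ G.Adj x y → ¬ G.Adj y x := fun x y h h' => h h'.symm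
  have hloop : ∀ x, ¬ G.Adj x x := fun x => G.loopless.irrefl x
  have na : ∀ w, G.Adj a w → w = b ∨ w = e := by
    intro w h; rcases hall w with rfl | rfl | rfl | rfl | rfl <;> simp_all
  have nb : ∀ w, G.Adj b w → w = a ∨ w = c := by
    intro w h; rcases hall w with rfl | rfl | rfl | rfl | rfl <;> simp_all
  have nc : ∀ w, G.Adj c w → w = b ∨ w = d := by
    intro w h; rcases hall w with rfl | rfl | rfl | rfl | rfl <;> simp_all
  have nd : ∀ w, G.Adj d w → w = c ∨ w = e := by
    intro w h; rcases hall w with rfl | rfl | rfl | rfl | rfl <;> simp_all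
  have ne : ∀ w, G.Adj e w → w = d ∨ w = a := by
    intro w h; rcases hall w with rfl | rfl | rfl | rfl | rfl <;> simp_all
  have dab := hab.ne
  have dbc := hbc.ne
  have dcd := hcd.ne
  have dde := hde.ne
  have dea := hea.ne
  have dac : a ≠ c := by rintro rfl; exact nda hcd.symm
  have dbd : b ≠ d := by rintro rfl; exact neb hde.symm
  have dce : c ≠ e := by rintro rfl; exact nac hea.symm
  have dda : d ≠ a := by rintro rfl; exact nbd hab.symm
  have deb : e ≠ b := by rintro rfl; exact nce hbc.symm
  -- Normal form: classes `{a, c}`, `{b, d}`, `{e}`. With four colours one is always spare.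
  let col : G.Coloring (Fin k) → Fin k → Fin k → Fin k → Prop := fun γ p q r =>
    γ a = p ∧ γ c = p ∧ γ b = q ∧ γ d = q ∧ γ e = r
  have col_ne : ∀ γ p q r, col γ p q r → p ≠ q ∧ q ≠ r ∧ p ≠ r := by
    rintro γ p q r ⟨h1, h2, h3, h4, h5⟩
    have := γ.valid hab
    have := γ.valid hde
    have := γ.valid hea
    exact ⟨by rwa [← h1, ← h3], by rwa [← h4, ← h5], by rw [← h1, ← h5]; exact this.symm⟩
  have fresh : ∀ p q r : Fin k, ∃ t, t ≠ p ∧ t ≠ q ∧ t ≠ r := by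
    intro p q r
    obtain ⟨t, ht⟩ := exists_colour_notMem {p, q, r} (lt_of_le_of_lt Finset.card_le_three hk)
    exact ⟨t, by simpa using ht⟩
  -- Taking `x = y` recolours a single vertex, still charged 2.
  have move : ∀ (γ : G.Coloring (Fin k)) x y t, ¬ G.Adj x y → (∀ w, G.Adj x w → γ w ≠ t) →
      (∀ w, G.Adj y w → γ w ≠ t) → ∃ γ' : G.Coloring (Fin k), γ' x = t ∧ γ' y = t ∧
        (∀ v, v ≠ x → v ≠ y → γ' v = γ v) ∧
        (recolouringGraph G k).edist γ γ' ≤ ((2 : ℕ) : ℕ∞) := by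
    intro γ x y t hxy hx hy
    obtain ⟨γ', h1, h2, h3⟩ := exists_recolour γ {x, y}
      (by intro u hu v hv _; simp at hu hv; rcases hu with rfl | rfl <;> rcases hv with rfl | rfl <;>
            simp [hxy, sym _ _ hxy]) t
      (by intro v hv; simp at hv; rcases hv with rfl | rfl <;> assumption)
    refine ⟨γ', h1 x (by simp), h1 y (by simp), fun v hvx hvy => h2 v (by simp [hvx, hvy]),
      h3.trans ?_⟩
    exact_mod_cast Finset.card_le_two
  have mvP : ∀ γ p q r t, col γ p q r → t ≠ q → t ≠ r → ∃ γ', col γ' t q r ∧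
      (recolouringGraph G k).edist γ γ' ≤ ((2 : ℕ) : ℕ∞) := by
    rintro γ p q r t ⟨h1, h2, h3, h4, h5⟩ hq hr
    obtain ⟨γ', g1, g2, g3, g4⟩ := move γ a c t nac
      (by intro w hw; rcases na w hw with h | h <;> simp only [h, h3, h5, hq.symm, hr.symm, ne_eq, not_false_iff])
      (by intro w hw; rcases nc w hw with h | h <;> simp only [h, h3, h4, hq.symm, ne_eq, not_false_iff])
    exact ⟨γ', ⟨g1, g2, (g3 b dab.symm dbc).trans h3, (g3 d dda dcd.symm).trans h4,
      (g3 e dea dce.symm).trans h5⟩, g4⟩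
  have mvQ : ∀ γ p q r t, col γ p q r → t ≠ p → t ≠ r → ∃ γ', col γ' p t r ∧
      (recolouringGraph G k).edist γ γ' ≤ ((2 : ℕ) : ℕ∞) := by
    rintro γ p q r t ⟨h1, h2, h3, h4, h5⟩ hp hr
    obtain ⟨γ', g1, g2, g3, g4⟩ := move γ b d t nbd
      (by intro w hw; rcases nb w hw with h | h <;> simp only [h, h1, h2, hp.symm, ne_eq, not_false_iff])
      (by intro w hw; rcases nd w hw with h | h <;> simp only [h, h2, h5, hp.symm, hr.symm, ne_eq, not_false_iff])
    exact ⟨γ', ⟨(g3 a dab dda.symm).trans h1, (g3 c dbc.symm dcd).trans h2, g1, g2,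
      (g3 e deb dde.symm).trans h5⟩, g4⟩
  have mvR : ∀ γ p q r t, col γ p q r → t ≠ p → t ≠ q → ∃ γ', col γ' p q t ∧
      (recolouringGraph G k).edist γ γ' ≤ ((2 : ℕ) : ℕ∞) := by
    rintro γ p q r t ⟨h1, h2, h3, h4, h5⟩ hp hq
    obtain ⟨γ', g1, -, g3, g4⟩ := move γ e e t (hloop e)
      (by intro w hw; rcases ne w hw with h | h <;> simp only [h, h1, h4, hp.symm, hq.symm, ne_eq, not_false_iff])
      (by intro w hw; rcases ne w hw with h | h <;> simp only [h, h1, h4, hp.symm, hq.symm, ne_eq, not_false_iff])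
    exact ⟨γ', ⟨(g3 a dea.symm dea.symm).trans h1, (g3 c dce dce).trans h2,
      (g3 b deb.symm deb.symm).trans h3, (g3 d dde dde).trans h4, g1⟩, g4⟩
  have toCol : ∀ γ : G.Coloring (Fin k), ∃ γ' p q r, col γ' p q r ∧
      (recolouringGraph G k).edist γ γ' ≤ ((6 : ℕ) : ℕ∞) := by
    intro γ
    -- Once `d` and `a` differ, `c` can copy `a`, and then `b` can copy `d`.
    obtain ⟨γ₁, h1, h2⟩ : ∃ γ₁ : G.Coloring (Fin k), γ₁ d ≠ γ₁ a ∧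
        (recolouringGraph G k).edist γ γ₁ ≤ ((2 : ℕ) : ℕ∞) := by
      by_cases h : γ d = γ a
      · obtain ⟨t, ht1, ht2, ht3⟩ := fresh (γ c) (γ e) (γ a)
        have hd : ∀ w, G.Adj d w → γ w ≠ t := by
          intro w hw
          rcases nd w hw with rfl | rfl
          exacts [ht1.symm, ht2.symm]
        obtain ⟨γ₁, g1, -, g2, g3⟩ := move γ d d t (hloop d) hd hd
        exact ⟨γ₁, by rw [g1, g2 a dda.symm dda.symm]; exact ht3, g3⟩
      · exact ⟨γ, h, by simp⟩
    have hc : ∀ w, G.Adj c w → γ₁ w ≠ γ₁ a := by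
      intro w hw
      rcases nc w hw with rfl | rfl
      exacts [(γ₁.valid hab).symm, h1]
    obtain ⟨γ₂, g1, -, g2, g3⟩ := move γ₁ c c (γ₁ a) (hloop c) hc hc
    have hac : γ₂ c = γ₂ a := by rw [g1, g2 a dac dac]
    have hb : ∀ w, G.Adj b w → γ₂ w ≠ γ₂ d := by
      intro w hw
      rcases nb w hw with rfl | rfl
      exacts [hac ▸ γ₂.valid hcd, γ₂.valid hcd]
    obtain ⟨γ₃, f1, -, f2, f3⟩ := move γ₂ b b (γ₂ d) (hloop b) hb hb
    exact ⟨γ₃, γ₂ a, γ₂ d, γ₃ e, ⟨f2 a dab dab, (f2 c dbc.symm dbc.symm).trans hac, f1,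
      f2 d dbd.symm dbd.symm, rfl⟩, edist_le_of_le_of_le (edist_le_of_le_of_le h2 g3) f3⟩
  -- If another class holds the target colour, it first moves to the spare colour.
  have fixP : ∀ γ p q r t, col γ p q r → ∃ γ' q' r', col γ' t q' r' ∧
      (recolouringGraph G k).edist γ γ' ≤ ((4 : ℕ) : ℕ∞) := by
    intro γ p q r t h
    obtain ⟨hpq, hqr, hpr⟩ := col_ne _ _ _ _ h
    obtain ⟨u, hu1, hu2, hu3⟩ := fresh p q r
    by_cases hq : t = q
    · subst hq
      obtain ⟨γ₁, h1, h2⟩ := mvQ γ p t r u h hu1 hu3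
      obtain ⟨γ₂, h3, h4⟩ := mvP γ₁ p u r t h1 hu2.symm hqr
      exact ⟨γ₂, _, _, h3, edist_le_of_le_of_le h2 h4⟩
    by_cases hr : t = r
    · subst hr
      obtain ⟨γ₁, h1, h2⟩ := mvR γ p q t u h hu1 hu2
      obtain ⟨γ₂, h3, h4⟩ := mvP γ₁ p q u t h1 hqr.symm hu3.symm
      exact ⟨γ₂, _, _, h3, edist_le_of_le_of_le h2 h4⟩
    obtain ⟨γ₁, h1, h2⟩ := mvP γ p q r t h hq hr
    exact ⟨γ₁, _, _, h1, h2.trans (by norm_num)⟩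
  have fixQ : ∀ γ p q r t, col γ p q r → t ≠ p → ∃ γ' r', col γ' p t r' ∧
      (recolouringGraph G k).edist γ γ' ≤ ((4 : ℕ) : ℕ∞) := by
    intro γ p q r t h htp
    obtain ⟨u, hu1, hu2, hu3⟩ := fresh p q r
    by_cases hr : t = r
    · subst hr
      obtain ⟨γ₁, h1, h2⟩ := mvR γ p q t u h hu1 hu2
      obtain ⟨γ₂, h3, h4⟩ := mvQ γ₁ p q u t h1 htp hu3.symm
      exact ⟨γ₂, _, h3, edist_le_of_le_of_le h2 h4⟩
    obtain ⟨γ₁, h1, h2⟩ := mvQ γ p q r t h htp hr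
    exact ⟨γ₁, _, h1, h2.trans (by norm_num)⟩
  obtain ⟨α', p, q, r, hα, h1⟩ := toCol α
  obtain ⟨β', p', q', r', hβ, h2⟩ := toCol β
  rw [SimpleGraph.edist_comm] at h2
  obtain ⟨γ, q₁, r₁, hγ, h3⟩ := fixP α' p q r p' hα
  obtain ⟨δ, r₂, hδ, h4⟩ := fixQ γ p' q₁ r₁ q' hγ (col_ne _ _ _ _ hβ).1.symm
  have h5 : (recolouringGraph G k).edist δ β' ≤ ((1 : ℕ) : ℕ∞) := by
    obtain ⟨a1, a2, a3, a4, -⟩ := hδ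
    obtain ⟨b1, b2, b3, b4, -⟩ := hβ
    refine (recolouringGraph_edist_le_card β' {e} (by simp) δ fun v hv => ?_).trans (by simp)
    rcases hall v with rfl | rfl | rfl | rfl | rfl
    exacts [a1.trans b1.symm, a3.trans b3.symm, a2.trans b2.symm, a4.trans b4.symm,
      absurd (Finset.mem_singleton_self v) hv]
  -- `21 = 6 + 4 + 4 + 1 + 6`.
  exact edist_le_of_le_of_le (edist_le_of_le_of_le (edist_le_of_le_of_le
    (edist_le_of_le_of_le h1 h3) h4) h5) h2

theorem five_le_card_of_five_cycle {V : Type*} [Fintype V] {G : SimpleGraph V}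
    (hT : G.CliqueFree 3) {a b c d e : V} (hab : G.Adj a b) (hbc : G.Adj b c) (hcd : G.Adj c d)
    (hde : G.Adj d e) (hea : G.Adj e a) : 5 ≤ Fintype.card V := by
  classical
  have tr : ∀ x y z, G.Adj x y → G.Adj x z → ¬ G.Adj y z := fun x y z =>
    not_adj_of_cliqueFree_three hT
  have dac : a ≠ c := by rintro rfl; exact tr e d a hde.symm hea hcd.symm
  have dbd : b ≠ d := by rintro rfl; exact tr a e b hea.symm hab hde.symm
  have dce : c ≠ e := by rintro rfl; exact tr b a c hab.symm hbc hea.symm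
  have dda : a ≠ d := by rintro rfl; exact tr c b a hbc.symm hcd hab.symm
  have deb : b ≠ e := by rintro rfl; exact tr d c b hcd.symm hde hbc.symm
  have h : ({a, b, c, d, e} : Finset V).card = 5 := by
    simp [Finset.card_insert_of_notMem, hab.ne, hbc.ne, hcd.ne, hde.ne, hea.ne', dac, dbd, dce,
      dda, deb]
  exact h ▸ Finset.card_le_univ _

/-! ### The diameter bound. -/

theorem mainTheorem6 {V : Type*} [Fintype V] (G : SimpleGraph V)
    (hTriangle : G.CliqueFree 3)
    (hCoDiamond : ¬ coDiamond.IsIndContained G)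
    (ℓ : ℕ) (hℓ : G.chromaticNumber + 1 ≤ (ℓ : ℕ∞))
    (hG : ¬ Nonempty (G ≃g completeBipartiteMinusPerfectMatching ℓ)) :
    (recolouringGraph G ℓ).ediam ≤ ((⌊(5.5 : ℚ) * (Fintype.card V : ℚ)⌋₊ : ℕ) : ℕ∞) := by
  classical
  have bound : ∀ m : ℕ, 2 * m ≤ 11 * Fintype.card V →
      (m : ℕ∞) ≤ ((⌊(5.5 : ℚ) * (Fintype.card V : ℚ)⌋₊ : ℕ) : ℕ∞) := by
    intro m hm
    have hm' : (2 : ℚ) * m ≤ 11 * Fintype.card V := by exact_mod_cast hm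
    exact_mod_cast Nat.le_floor (by linarith : (m : ℚ) ≤ 5.5 * Fintype.card V)
  rw [SimpleGraph.ediam_le_iff]
  intro α β
  by_cases hE : ∃ x y, G.Adj x y
  swap
  · push Not at hE
    refine (recolouringGraph_edist_le_card β Finset.univ (fun x _ y _ _ => hE x y) α
      (by simp)).trans (bound _ ?_)
    rw [Finset.card_univ]
    omega
  obtain ⟨x, y, hxy⟩ := hE
  have colourable : ∀ m, ℓ ≤ m + 1 → G.Colorable m := by
    intro m hm
    rw [← SimpleGraph.chromaticNumber_le_iff_colorable]
    have : G.chromaticNumber + 1 ≤ (m : ℕ∞) + 1 := hℓ.trans (by exact_mod_cast hm)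
    exact (ENat.add_le_add_iff_right (by simp)).1 this
  by_cases hP : ∃ P : V → Prop, ∀ x y, G.Adj x y → (P x ↔ ¬ P y)
  · obtain ⟨P, hP⟩ := hP
    have hk : 3 ≤ ℓ := by
      by_contra h
      obtain ⟨C⟩ := colourable 1 (by omega)
      exact C.valid hxy (Subsingleton.elim _ _)
    have missing : ∀ γ : G.Coloring (Fin ℓ),
        ∃ c, (∀ v ∈ Finset.univ.filter P, γ v ≠ c) ∨
          ∀ v ∈ Finset.univ.filter fun v => ¬ P v, γ v ≠ c := by
      intro γ
      by_contra! h
      exact hG (nonempty_iso_of_forall_colour hCoDiamond P hP (by omega) hxy γ fun c => by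
        simpa using h c)
    have h := edist_le_of_missing (A := Finset.univ.filter P)
      (B := Finset.univ.filter fun v => ¬ P v)
      (fun u hu v hv _ huv => by have := hP u v huv; simp_all)
      (fun u hu v hv _ huv => by have := hP u v huv; simp_all)
      (by simp) hk α β (missing α) (missing β)
    refine h.trans (bound _ ?_)
    rw [Finset.card_filter_add_card_filter_not, Finset.card_univ]
    omega
  · obtain ⟨a, b, c, d, e, hab, hbc, hcd, hde, hea⟩ := exists_five_cycle hTriangle hCoDiamond hP
    have hk : 4 ≤ ℓ := by
      by_contra h
      -- If `ℓ ≤ 3`, then `χ(G) ≤ 2`, and a 2-colouring would be a bipartition.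
      obtain ⟨C⟩ := colourable 2 (by omega)
      refine hP ⟨fun v => C v = 0, fun u v huv => ?_⟩
      have := C.valid huv
      omega
    have h5 := five_le_card_of_five_cycle hTriangle hab hbc hcd hde hea
    exact (edist_le_of_five_cycle hTriangle hab hbc hcd hde hea
      (eq_of_five_cycle hTriangle hCoDiamond hab hbc hcd hde hea) hk α β).trans
      (bound _ (by omega))
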